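/- **Setting.** Let $p\ge 0$, $n_1,\dots,n_p\ge 1$, $n=n_1\cdots n_p$, $1\le k\le t$. All tensors are real. For tensors of size $a\times b\times n_1\times\cdots\times n_p$, indices of the last $p$ modes are taken modulo $(n_1,\dots,n_p)$, and $A_{\mathcal F}(f)\in\mathbb C^{a\times b}$ denotes the face slice at frequency $f$ of the unnormalized discrete Fourier transform of $A$ along the last $p$ modes. The t-product is $[A*B](i,j,\cdot)=\sum_m A(i,m,\cdot)\star B(m,j,\cdot)$ with $\star$ circular convolution; equivalently $(A*B)_{\mathcal F}(f)=A_{\mathcal F}(f)B_{\mathcal F}(f)$. The transpose $A^{\mathrm T}$ is the tensor with $(A^{\mathrm T})_{\mathcal F}(f)=A_{\mathcal F}(f)^{\mathrm H}$, and the identity tensor $\mathcal I$ is the one all of whose Fourier face slices are identity matrices. A *t-SVD* of $Z$ is a factorization $Z=U*S*V^{\mathrm T}$ with $U,V$ orthogonal ($U^{\mathrm T}*U=U*U^{\mathrm T}=\mathcal I$, likewise for $V$), all face slices of $S$ diagonal, and the diagonal entries of each $S_{\mathcal F}(f)$ real, nonnegative and nonincreasing. The *t-SVD rank* of $Z$ is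 $\#\{i: S(i,i,:,\dots,:)\ne 0\}$. A *skinny t-SVD* of $Z$ (of t-SVD rank $r$) is such a factorization with $U,S,V$ having $a\times r$, $r\times r$, $b\times r$ as first two dimensions and with $U^{\mathrm T}*U=V^{\mathrm T}*V=\mathcal I_r$. The *multi-rank sum* is $r_s=\sum_f\operatorname{rank} Z_{\mathcal F}(f)$. The *tensor nuclear norm* $\|Z\|_\circledast$ is $\frac1n$ times the nuclear norm of the block-diagonal matrix with blocks $Z_{\mathcal F}(f)$. For $M\in\mathbb R^{t\times n_1\times\cdots\times n_p}$, the temporal Hankel tensor $\mathcal H_k(M)\in\mathbb R^{t\times k\times n_1\times\cdots\times n_p}$ is $$\mathcal H_k(M)(i,j,\cdot)=\tfrac1{\sqrt k}\,M(i+j-1,\cdot),\qquad 1\le i\le t,\ 1\le j\le k,$$ with the time index taken modulo $t$. $M$ satisfies the *temporal Hankel tensor incoherence conditions* with size coefficient $k$ and parameter $\mu>0$ if $\mathcal H_k(M)$, of t-SVD rank $r$, has a skinny t-SVD $U*S*V^{\mathrm T}$ with $$\max_{1\le i\le t}\|U^{\mathrm T}*\mathring e_t^{(i)}\|_F\le\sqrt{\frac{\mu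 r}{tn}},\qquad \max_{1\le i\le k}\|V^{\mathrm T}*\mathring e_k^{(i)}\|_F\le\sqrt{\frac{\mu r}{kn}},$$ where $\mathring e_a^{(i)}$ is the $a\times1\times n_1\times\cdots\times n_p$ tensor with entry $1$ at position $(i,1,1,\dots,1)$ and $0$ elsewhere. For $\Omega\subseteq[t]\times[n_1]\times\cdots\times[n_p]$, $P_\Omega$ keeps the entries in $\Omega$ and sets the others to $0$, and the minimum temporal sampling rate is $$\rho(\Omega)=\min_{i_1,\dots,i_p}\frac{\#\{i : (i,i_1,\dots,i_p)\in\Omega\}}{t}.$$ **Theorem (exact recovery).** Suppose $M\in\mathbb R^{t\times n_1\times\cdots\times n_p}$ satisfies the temporal Hankel tensor incoherence conditions with size coefficient $k$ and parameter $\mu>0$. Let $r$ be the t-SVD rank and $r_s$ the multi-rank sum of $\mathcal H_k(M)$, and let $\Omega\subseteq[t]\times[n_1]\times\cdots\times[n_p]$ satisfy $$\rho(\Omega)>1-\frac{k}{2\mu r(r_s+1)t}$$ (no condition on $\Omega$ is imposed in the degenerate case $r=0$, i.e. $M=0$). Then $M$ is the unique solution of $$\min_{X\in\mathbb R^{t\times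 n_1\times\cdots\times n_p}}\|\mathcal H_k(X)\|_\circledast\quad\text{subject to}\quad P_\Omega(X)=P_\Omega(M).$$ -/

import Mathlib

noncomputable section

namespace TIDT

/-- Multi-indices of the trailing modes, `[n₁] × ⋯ × [n_p]` (0-based). Its addition is
componentwise modular addition. -/
abbrev Idx {p : ℕ} (n : Fin p → ℕ) : Type := (j : Fin p) → Fin (n j)

/-- Real tensors of size `t × n₁ × ⋯ × n_p` (multidimensional time series). -/
abbrev Series {p : ℕ} (n : Fin p → ℕ) (t : ℕ) : Type := Fin t → Idx n → ℝ

/-- Real tensors of size `a × b × n₁ × ⋯ × n_p`. -/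
abbrev Tensor {p : ℕ} (n : Fin p → ℕ) (a b : ℕ) : Type := Fin a → Fin b → Idx n → ℝ

/-! ### t-product algebra -/

section Algebra

variable {p : ℕ} {n : Fin p → ℕ} [∀ j, NeZero (n j)] {a b c : ℕ}

/-- Multidimensional circular convolution of tubes. -/
def conv (x y : Idx n → ℝ) : Idx n → ℝ := fun l => ∑ q, x q * y (l - q)

/-- The t-product `A * B`. -/
def tprod (A : Tensor n a b) (B : Tensor n b c) : Tensor n a c :=
  fun i j l => ∑ m, conv (A i m) (B m j) l

/-- The tensor transpose: faces are transposed and the trailing indices are reflected.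
Equivalently, every Fourier-domain face slice is replaced by its conjugate transpose. -/
def ttranspose (A : Tensor n a b) : Tensor n b a := fun i j l => A j i (-l)

/-- The identity tensor of the t-product: its zeroth face slice is the identity matrix and its
other face slices vanish. Equivalently, every Fourier-domain face slice is the identity matrix. -/
def idTensor (n : Fin p → ℕ) [∀ j, NeZero (n j)] (a : ℕ) : Tensor n a a :=
  fun i j l => if i = j ∧ l = 0 then 1 else 0

/-- The Fourier-domain face slice of `A` at frequency `f`: the unnormalized discrete Fourier
transform along the trailing `p` modes. -/
def faceF (A : Tensor n a b) (f : Idx n) : Matrix (Fin a) (Fin b) ℂ :=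
  Matrix.of fun i j => ∑ l : Idx n,
    Complex.exp (-(2 * Real.pi * Complex.I) *
      ∑ s : Fin p, ((f s : ℕ) : ℂ) * ((l s : ℕ) : ℂ) / ((n s : ℕ) : ℂ)) * (A i j l : ℂ)

/-- The Frobenius norm. -/
def frobNorm (A : Tensor n a b) : ℝ := Real.sqrt (∑ i, ∑ j, ∑ l, A i j l ^ 2)

/-- All face slices are diagonal. -/
def FDiagonal (S : Tensor n a b) : Prop :=
  ∀ (i : Fin a) (j : Fin b), (i : ℕ) ≠ (j : ℕ) → ∀ l, S i j l = 0

/-- The diagonal entries of every Fourier-domain face slice are real, nonnegative and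
nonincreasing, i.e. they are singular values in the usual order. -/
def OrderedDiagonal (S : Tensor n a b) : Prop :=
  ∀ f : Idx n,
    (∀ (i : Fin a) (j : Fin b), (i : ℕ) = (j : ℕ) →
      (faceF S f i j).im = 0 ∧ 0 ≤ (faceF S f i j).re) ∧
    (∀ (i i' : Fin a) (j j' : Fin b), (i : ℕ) = (j : ℕ) → (i' : ℕ) = (j' : ℕ) → i ≤ i' →
      (faceF S f i' j').re ≤ (faceF S f i j).re)

/-- Orthogonal tensors. -/
def IsOrthogonal (U : Tensor n a a) : Prop :=
  tprod (ttranspose U) U = idTensor n a ∧ tprod U (ttranspose U) = idTensor n a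

/-- `Z = U * S * Vᵀ` is a (full) t-SVD. -/
def IsTSVD (Z : Tensor n a b) (U : Tensor n a a) (S : Tensor n a b) (V : Tensor n b b) : Prop :=
  IsOrthogonal U ∧ IsOrthogonal V ∧ FDiagonal S ∧ OrderedDiagonal S ∧
    Z = tprod (tprod U S) (ttranspose V)

/-- `r` is the t-SVD rank of `Z`: the number of nonzero diagonal tubes of `S` in a t-SVD. -/
def IsTSVDRank (Z : Tensor n a b) (r : ℕ) : Prop :=
  ∃ (U : Tensor n a a) (S : Tensor n a b) (V : Tensor n b b), IsTSVD Z U S V ∧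
    r = Set.ncard {i : ℕ | ∃ (hi : i < a) (hj : i < b), S ⟨i, hi⟩ ⟨i, hj⟩ ≠ 0}

/-- `Z = U * S * Vᵀ` is a skinny t-SVD with `r` singular tubes. -/
def IsSkinnyTSVD {r : ℕ} (Z : Tensor n a b) (U : Tensor n a r) (S : Tensor n r r)
    (V : Tensor n b r) : Prop :=
  tprod (ttranspose U) U = idTensor n r ∧ tprod (ttranspose V) V = idTensor n r ∧
    FDiagonal S ∧ OrderedDiagonal S ∧ Z = tprod (tprod U S) (ttranspose V)

/-- The multi-rank, indexed by the frequencies. -/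
def multiRank (Z : Tensor n a b) (f : Idx n) : ℕ := (faceF Z f).rank

/-- The multi-rank sum. -/
def multiRankSum (Z : Tensor n a b) : ℕ := ∑ f, multiRank Z f

end Algebra

/-- The nuclear norm of a complex matrix: the sum of its singular values. -/
def nuclearNorm {m m' : Type*} [Fintype m] [Fintype m'] [DecidableEq m']
    (A : Matrix m m' ℂ) : ℝ :=
  (Matrix.toEuclideanLin A).singularValues.sum fun _ s => s

section Model

variable {p : ℕ} {n : Fin p → ℕ} [∀ j, NeZero (n j)] {t : ℕ}

/-- The tensor nuclear norm: the nuclear norm of the block-diagonal matrix of the Fourier-domain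
face slices, divided by `n₁ ⋯ n_p`. -/
def tensorNuclearNorm {a b : ℕ} (Z : Tensor n a b) : ℝ :=
  (1 / ((∏ j, n j : ℕ) : ℝ)) * nuclearNorm (Matrix.blockDiagonal fun f => faceF Z f)

/-- The temporal isometric delay-embedding (temporal Hankel) transform with `k` columns. -/
def hankel (k : ℕ) (M : Series n t) : Tensor n t k :=
  fun i j l => (1 / Real.sqrt k) *
    M ⟨((i : ℕ) + (j : ℕ)) % t, Nat.mod_lt _ i.pos⟩ l

/-- The tensor column basis element of size `a × 1 × n₁ × ⋯ × n_p`, with entry `1` at position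
`(i, 1, 1, …, 1)` (in 1-based indexing) and zeros elsewhere. -/
def colBasis (n : Fin p → ℕ) [∀ j, NeZero (n j)] {a : ℕ} (i : Fin a) : Tensor n a 1 :=
  fun i' _ l => if i' = i ∧ l = 0 then 1 else 0

/-- The temporal Hankel tensor incoherence conditions with size coefficient `k`, parameter `μ`
and temporal Hankel rank `r`. -/
def HankelIncoherent (k : ℕ) (μ : ℝ) (r : ℕ) (M : Series n t) : Prop :=
  IsTSVDRank (hankel k M) r ∧
  ∃ (U : Tensor n t r) (S : Tensor n r r) (V : Tensor n k r),
    IsSkinnyTSVD (hankel k M) U S V ∧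
    (∀ i : Fin t, frobNorm (tprod (ttranspose U) (colBasis n i)) ≤
      Real.sqrt (μ * r / (t * ((∏ j, n j : ℕ) : ℝ)))) ∧
    (∀ i : Fin k, frobNorm (tprod (ttranspose V) (colBasis n i)) ≤
      Real.sqrt (μ * r / (k * ((∏ j, n j : ℕ) : ℝ))))

/-- The temporal sampling number: how many time points are observed in the series at `l`. -/
def samplingNumber (Ω : Finset (Fin t × Idx n)) (l : Idx n) : ℕ :=
  (Finset.univ.filter fun i : Fin t => (i, l) ∈ Ω).card

/-- The minimum temporal sampling rate `ρ(Ω)`. -/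
def samplingRate (Ω : Finset (Fin t × Idx n)) : ℝ :=
  Finset.univ.inf' Finset.univ_nonempty fun l : Idx n => (samplingNumber Ω l : ℝ) / t

/-- The sampling operator `P_Ω`. -/
def sample (Ω : Finset (Fin t × Idx n)) (X : Series n t) : Series n t :=
  fun i l => if (i, l) ∈ Ω then X i l else 0

/-- `X` solves the noiseless model: minimize `‖H_k(Y)‖_⊛` over all real `Y` of the same size
with `P_Ω(Y) = P_Ω(M)`. -/
def IsSolution (k : ℕ) (Ω : Finset (Fin t × Idx n)) (M X : Series n t) : Prop :=
  sample Ω X = sample Ω M ∧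
    ∀ Y : Series n t, sample Ω Y = sample Ω M →
      tensorNuclearNorm (hankel k X) ≤ tensorNuclearNorm (hankel k Y)

end Model

end TIDT

end

noncomputable section

open Matrix

namespace TIDT

section SingularValues

open Module InnerProductSpace

variable {E F : Type*} [NormedAddCommGroup E] [InnerProductSpace ℂ E] [FiniteDimensional ℂ E]
  [NormedAddCommGroup F] [InnerProductSpace ℂ F] [FiniteDimensional ℂ F]

theorem singularValues_sum_eq (T : E →ₗ[ℂ] F) :
    (T.singularValues.sum fun _ s => s) = ∑ i : Fin (finrank ℂ E), T.singularValues i := by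
  rw [Finsupp.sum_of_support_subset _ (s := Finset.range (finrank ℂ E)), Finset.sum_range]
  · intro i hi
    rw [Finset.mem_range]
    by_contra h
    exact (Finsupp.mem_support_iff.1 hi) (T.singularValues_of_finrank_le (not_lt.1 h))
  · simp

/-- An orthonormal basis of right singular vectors. -/
def rightSingularBasis (T : E →ₗ[ℂ] F) : OrthonormalBasis (Fin (finrank ℂ E)) ℂ E :=
  T.isSymmetric_adjoint_comp_self.eigenvectorBasis rfl

theorem inner_apply_rightSingularBasis (T : E →ₗ[ℂ] F) (i j : Fin (finrank ℂ E)) :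
    inner ℂ (T (rightSingularBasis T i)) (T (rightSingularBasis T j)) =
      if i = j then ((T.singularValues i : ℂ)) ^ 2 else 0 := by
  have h := T.isSymmetric_adjoint_comp_self.apply_eigenvectorBasis rfl j
  rw [← LinearMap.adjoint_inner_right]
  change inner ℂ (rightSingularBasis T i) ((LinearMap.adjoint T ∘ₗ T) (rightSingularBasis T j)) = _
  rw [rightSingularBasis, h, inner_smul_right, OrthonormalBasis.inner_eq_ite,
    ← T.sq_singularValues_fin]
  split_ifs with hij
  · subst hij; simp
  · simp

theorem norm_apply_rightSingularBasis (T : E →ₗ[ℂ] F) (i : Fin (finrank ℂ E)) :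
    ‖T (rightSingularBasis T i)‖ = T.singularValues i := by
  have h := inner_apply_rightSingularBasis T i i
  rw [if_pos rfl, inner_self_eq_norm_sq_to_K] at h
  have h' : ‖T (rightSingularBasis T i)‖ ^ 2 = T.singularValues i ^ 2 :=
    Complex.ofReal_injective (by push_cast; exact h)
  exact (sq_eq_sq₀ (norm_nonneg _) (T.singularValues_nonneg _)).1 h'

theorem sum_re_inner_le_sum_singularValues (T B : E →ₗ[ℂ] F) (hB : ∀ v, ‖B v‖ ≤ ‖v‖) :
    ∑ i, (inner ℂ (B (rightSingularBasis T i)) (T (rightSingularBasis T i))).re ≤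
      T.singularValues.sum fun _ s => s := by
  rw [singularValues_sum_eq]
  refine Finset.sum_le_sum fun i _ => ?_
  calc _ ≤ ‖inner ℂ (B (rightSingularBasis T i)) (T (rightSingularBasis T i))‖ :=
        Complex.re_le_norm _
    _ ≤ ‖B (rightSingularBasis T i)‖ * ‖T (rightSingularBasis T i)‖ := norm_inner_le_norm _ _
    _ ≤ 1 * T.singularValues i := by
        rw [norm_apply_rightSingularBasis]
        have := hB (rightSingularBasis T i)
        rw [OrthonormalBasis.norm_eq_one] at this
        exact mul_le_mul_of_nonneg_right this (T.singularValues_nonneg _)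
    _ = _ := one_mul _

/-- The nuclear norm is at most the total weight of any decomposition into rank-one operators with
factors in the unit ball. -/
theorem sum_singularValues_le {ι : Type*} [Fintype ι] (T : E →ₗ[ℂ] F) (s : ι → ℝ)
    (hs : ∀ m, 0 ≤ s m) (u : ι → F) (v : ι → E) (hu : ∀ m, ‖u m‖ ≤ 1) (hv : ∀ m, ‖v m‖ ≤ 1)
    (hT : ∀ x, T x = ∑ m, ((s m : ℂ) * inner ℂ (v m) x) • u m) :
    (T.singularValues.sum fun _ s => s) ≤ ∑ m, s m := by
  classical
  rw [singularValues_sum_eq]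
  set b := rightSingularBasis T
  set K : Finset (Fin (finrank ℂ E)) := Finset.univ.filter fun i => T.singularValues i ≠ 0
  have hK : ∑ i : Fin (finrank ℂ E), T.singularValues i = ∑ i : K, T.singularValues i.1 := by
    rw [Finset.sum_coe_sort K (fun i => T.singularValues i)]
    refine (Finset.sum_subset (Finset.subset_univ _) fun i _ hi => ?_).symm
    simpa [K] using hi
  have hpos : ∀ i : K, (T.singularValues i.1 : ℂ) ≠ 0 := fun i => by
    exact_mod_cast (Finset.mem_filter.1 i.2).2
  let w : K → F := fun i => ((T.singularValues i.1 : ℂ)⁻¹) • T (b i.1)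
  have hw : Orthonormal ℂ w := by
    rw [orthonormal_iff_ite]
    intro i j
    simp only [w, inner_smul_left, inner_smul_right]
    rw [inner_apply_rightSingularBasis]
    by_cases hij : i = j
    · subst hij
      have := hpos i
      simp
      field_simp
    · rw [if_neg (fun h => hij (Subtype.ext h)), if_neg hij]; simp
  have hval : ∀ i : K, T.singularValues i.1 =
      ∑ m, s m * (inner ℂ (v m) (b i.1) * inner ℂ (w i) (u m)).re := by
    intro i
    have h1 : inner ℂ (w i) (T (b i.1)) = (T.singularValues i.1 : ℂ) := by
      simp only [w, inner_smul_left]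
      rw [inner_apply_rightSingularBasis, if_pos rfl]
      have := hpos i
      simp
      field_simp
    rw [hT, inner_sum] at h1
    have h2 := congrArg Complex.re h1
    rw [Complex.ofReal_re, Complex.re_sum] at h2
    rw [← h2]
    refine Finset.sum_congr rfl fun m _ => ?_
    rw [inner_smul_right, mul_assoc, Complex.re_ofReal_mul]
  rw [hK, Finset.sum_congr rfl fun i _ => hval i, Finset.sum_comm]
  refine Finset.sum_le_sum fun m _ => ?_
  rw [← Finset.mul_sum]
  refine mul_le_of_le_one_right (hs m) ?_
  have hA : ∑ i : K, ‖inner ℂ (v m) (b i.1)‖ ^ 2 ≤ 1 := by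
    have h := b.orthonormal.sum_inner_products_le (v m) (s := K)
    rw [← Finset.sum_coe_sort K] at h
    simp only [norm_inner_symm (v m)]
    exact h.trans (pow_le_one₀ (norm_nonneg _) (hv m))
  have hB : ∑ i : K, ‖inner ℂ (w i) (u m)‖ ^ 2 ≤ 1 :=
    (hw.sum_inner_products_le (u m) (s := Finset.univ)).trans (pow_le_one₀ (norm_nonneg _) (hu m))
  have hAB : ∀ i : K, (inner ℂ (v m) (b i.1) * inner ℂ (w i) (u m)).re ≤
      (‖inner ℂ (v m) (b i.1)‖ ^ 2 + ‖inner ℂ (w i) (u m)‖ ^ 2) / 2 := by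
    intro i
    refine (Complex.re_le_norm _).trans ?_
    rw [norm_mul]
    nlinarith [sq_nonneg (‖inner ℂ (v m) (b i.1)‖ - ‖inner ℂ (w i) (u m)‖)]
  refine (Finset.sum_le_sum fun i _ => hAB i).trans ?_
  rw [← Finset.sum_div, Finset.sum_add_distrib]
  linarith

end SingularValues

section Cancel

variable {a b c e : Type*} [Fintype b] [Fintype c]

theorem mul_mul_of_mul_eq {A : Matrix a b ℂ} {B : Matrix b c ℂ} {C : Matrix a c ℂ}
    (h : A * B = C) (X : Matrix c e ℂ) : A * (B * X) = C * X := by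
  rw [← Matrix.mul_assoc, h]

theorem mul_mul_cancel_of_isometry [DecidableEq c] {U : Matrix b c ℂ} (h : Uᴴ * U = 1)
    (X : Matrix c e ℂ) : Uᴴ * (U * X) = X := by
  rw [← Matrix.mul_assoc, h, Matrix.one_mul]

end Cancel

section FrobSq

variable {l m m' : Type*} [Fintype l] [Fintype m] [Fintype m']

/-- The squared Frobenius norm of a complex matrix. -/
def frobSq (A : Matrix m m' ℂ) : ℝ := ∑ i, ∑ j, ‖A i j‖ ^ 2

theorem frobSq_nonneg (A : Matrix m m' ℂ) : 0 ≤ frobSq A :=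
  Finset.sum_nonneg fun _ _ => Finset.sum_nonneg fun _ _ => sq_nonneg _

theorem trace_conjTranspose_mul_eq_sum (A B : Matrix m m' ℂ) :
    (Aᴴ * B).trace = ∑ i, ∑ j, star (A i j) * B i j := by
  simp only [trace, diag_apply, mul_apply, conjTranspose_apply]
  exact Finset.sum_comm

theorem trace_conjTranspose_mul_self_re (A : Matrix m m' ℂ) : (Aᴴ * A).trace.re = frobSq A := by
  rw [trace_conjTranspose_mul_eq_sum, frobSq]
  simp only [Complex.re_sum]
  refine Finset.sum_congr rfl fun i _ => Finset.sum_congr rfl fun j _ => ?_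
  rw [Complex.star_def, ← Complex.normSq_eq_conj_mul_self, Complex.ofReal_re,
    Complex.normSq_eq_norm_sq]

theorem frobSq_conjTranspose (A : Matrix m m' ℂ) : frobSq Aᴴ = frobSq A := by
  simp only [frobSq, conjTranspose_apply, norm_star]
  exact Finset.sum_comm

theorem frobSq_smul (c : ℂ) (A : Matrix m m' ℂ) : frobSq (c • A) = ‖c‖ ^ 2 * frobSq A := by
  simp [frobSq, mul_pow, Finset.mul_sum]

theorem frobSq_add_of_conjTranspose_mul_eq_zero {A B : Matrix m m' ℂ} (h : Aᴴ * B = 0) :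
    frobSq (A + B) = frobSq A + frobSq B := by
  have h' : Bᴴ * A = 0 := by
    have := congrArg conjTranspose h
    simpa using this
  simp only [← trace_conjTranspose_mul_self_re]
  rw [conjTranspose_add, Matrix.add_mul, Matrix.mul_add, Matrix.mul_add, h, h']
  simp

theorem frobSq_mul_of_isometry [DecidableEq m] {U : Matrix l m ℂ} (hU : Uᴴ * U = 1)
    (A : Matrix m m' ℂ) : frobSq (U * A) = frobSq A := by
  simp only [← trace_conjTranspose_mul_self_re]
  rw [conjTranspose_mul, Matrix.mul_assoc, ← Matrix.mul_assoc Uᴴ, hU, Matrix.one_mul]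

theorem frobSq_diagonal_mul_le [DecidableEq m] {d : m → ℂ} (hd : ∀ i, ‖d i‖ ≤ 1)
    (A : Matrix m m' ℂ) : frobSq (diagonal d * A) ≤ frobSq A := by
  refine Finset.sum_le_sum fun i _ => Finset.sum_le_sum fun j _ => ?_
  rw [diagonal_mul, norm_mul]
  gcongr
  exact mul_le_of_le_one_left (norm_nonneg _) (hd i)

theorem frobSq_mul_le (A : Matrix l m ℂ) (B : Matrix m m' ℂ) :
    frobSq (A * B) ≤ frobSq A * frobSq B := by
  have hB : frobSq B = ∑ j, ∑ i, ‖B i j‖ ^ 2 := Finset.sum_comm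
  rw [hB]
  simp only [frobSq]
  rw [Finset.sum_mul_sum]
  refine Finset.sum_le_sum fun i _ => Finset.sum_le_sum fun j _ => ?_
  calc ‖(A * B) i j‖ ^ 2 ≤ (∑ q, ‖A i q‖ * ‖B q j‖) ^ 2 := by
        rw [mul_apply]
        gcongr
        exact (norm_sum_le _ _).trans (by simp)
    _ ≤ _ := Finset.sum_mul_sq_le_sq_mul_sq _ _ _

theorem re_trace_sq_le (A B : Matrix m m' ℂ) :
    (Aᴴ * B).trace.re ^ 2 ≤ frobSq A * frobSq B := by
  have h : |(Aᴴ * B).trace.re| ≤ ∑ x : m × m', ‖A x.1 x.2‖ * ‖B x.1 x.2‖ := by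
    rw [trace_conjTranspose_mul_eq_sum, ← Finset.univ_product_univ, Finset.sum_product]
    refine (Complex.abs_re_le_norm _).trans ((norm_sum_le _ _).trans ?_)
    refine Finset.sum_le_sum fun i _ => (norm_sum_le _ _).trans ?_
    simp
  have hs : ∀ C : Matrix m m' ℂ, frobSq C = ∑ x : m × m', ‖C x.1 x.2‖ ^ 2 := fun C => by
    rw [← Finset.univ_product_univ, Finset.sum_product]; rfl
  rw [hs, hs, ← sq_abs]
  exact (pow_le_pow_left₀ (abs_nonneg _) h 2).trans (Finset.sum_mul_sq_le_sq_mul_sq _ _ _)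

end FrobSq

section NuclearNorm

variable {l m m' : Type*} [Fintype m] [Fintype m']

theorem norm_toEuclideanLin_sq [DecidableEq m'] (B : Matrix m m' ℂ) (v : EuclideanSpace ℂ m') :
    ‖toEuclideanLin B v‖ ^ 2 = frobSq (B * replicateCol Unit v.ofLp) := by
  rw [EuclideanSpace.norm_sq_eq]
  simp [frobSq, mul_apply, mulVec, dotProduct]

theorem norm_sq_eq_frobSq_replicateCol (v : EuclideanSpace ℂ m') :
    ‖v‖ ^ 2 = frobSq (replicateCol Unit v.ofLp) := by
  rw [EuclideanSpace.norm_sq_eq]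
  simp [frobSq]

theorem norm_col_le_one [DecidableEq l] {W : Matrix m l ℂ} (hW : Wᴴ * W = 1) (i : l) :
    ‖(WithLp.toLp 2 fun a => W a i : EuclideanSpace ℂ m)‖ ≤ 1 := by
  have h := congrFun (congrFun hW i) i
  rw [mul_apply, one_apply_eq] at h
  have h' := congrArg Complex.re h
  refine le_of_sq_le_sq ?_ zero_le_one
  rw [EuclideanSpace.norm_sq_eq, one_pow]
  refine le_of_eq ?_
  rw [← Complex.one_re, ← h', Complex.re_sum]
  refine Finset.sum_congr rfl fun a _ => ?_
  rw [conjTranspose_apply, Complex.star_def, ← Complex.normSq_eq_conj_mul_self,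
    Complex.ofReal_re, Complex.normSq_eq_norm_sq]

/-- Trace duality between the nuclear and the operator norm. -/
theorem re_trace_le_nuclearNorm [DecidableEq m] [DecidableEq m'] (A B : Matrix m m' ℂ)
    (hB : ∀ x : Matrix m' Unit ℂ, frobSq (B * x) ≤ frobSq x) :
    (Bᴴ * A).trace.re ≤ nuclearNorm A := by
  have h := sum_re_inner_le_sum_singularValues (toEuclideanLin A) (toEuclideanLin B) (by
    intro v
    refine le_of_sq_le_sq ?_ (norm_nonneg _)
    rw [norm_toEuclideanLin_sq, norm_sq_eq_frobSq_replicateCol]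
    exact hB _)
  refine le_trans (le_of_eq ?_) h
  rw [← Complex.re_sum]
  congr 1
  simp only [← LinearMap.adjoint_inner_right]
  rw [← Matrix.toEuclideanLin_conjTranspose_eq_adjoint]
  have := LinearMap.trace_eq_sum_inner
    (toEuclideanLin Bᴴ ∘ₗ toEuclideanLin A) (rightSingularBasis (toEuclideanLin A))
  simp only [LinearMap.comp_apply] at this
  rw [← this]
  have h2 : toEuclideanLin Bᴴ ∘ₗ toEuclideanLin A = toEuclideanLin (Bᴴ * A) := by
    ext1 x; simp
  rw [h2, toEuclideanLin_eq_toLin_orthonormal, Matrix.trace_toLin_eq]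

variable [Fintype l] [DecidableEq l] [DecidableEq m']

theorem nuclearNorm_mul_diagonal_mul_le {U : Matrix m l ℂ} {V : Matrix m' l ℂ} (hU : Uᴴ * U = 1)
    (hV : Vᴴ * V = 1) {s : l → ℝ} (hs : ∀ i, 0 ≤ s i) :
    nuclearNorm (U * diagonal (fun i => (s i : ℂ)) * Vᴴ) ≤ ∑ i, s i := by
  refine sum_singularValues_le _ s hs (fun i => WithLp.toLp 2 fun a => U a i)
    (fun i => WithLp.toLp 2 fun a => V a i) (norm_col_le_one hU)
    (norm_col_le_one hV) fun x => ?_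
  ext a
  simp only [toLpLin_apply, mulVec, dotProduct, PiLp.inner_apply, WithLp.ofLp_sum, Finset.sum_apply,
    WithLp.ofLp_smul, Pi.smul_apply, smul_eq_mul, RCLike.inner_apply]
  simp only [Matrix.mul_assoc, mul_apply (M := U), diagonal_mul, conjTranspose_apply,
    Finset.sum_mul, Finset.mul_sum]
  rw [Finset.sum_comm]
  refine Finset.sum_congr rfl fun i _ => Finset.sum_congr rfl fun j _ => ?_
  simp only [Complex.star_def]
  ring

/-- A perturbation whose component tangent to the variety of low-rank matrices is small in the
Frobenius norm strictly increases the nuclear norm. -/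
theorem nuclearNorm_lt_nuclearNorm_add [DecidableEq m] {U : Matrix m l ℂ} {V : Matrix m' l ℂ}
    (hU : Uᴴ * U = 1) (hV : Vᴴ * V = 1) {s : l → ℝ} (hs : ∀ i, 0 ≤ s i) {ρ : ℕ}
    (hρ : (Finset.univ.filter fun i => s i ≠ 0).card ≤ ρ) (N : Matrix m m' ℂ)
    (hN : ((ρ : ℝ) + 1) * (frobSq (Uᴴ * N) + frobSq (N * V)) < frobSq N) :
    nuclearNorm (U * diagonal (fun i => (s i : ℂ)) * Vᴴ) <
      nuclearNorm (U * diagonal (fun i => (s i : ℂ)) * Vᴴ + N) := by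
  set S : Matrix l l ℂ := diagonal fun i => (s i : ℂ) with hS
  set d : l → ℂ := fun i => if s i = 0 then 0 else 1 with hd
  set J : Matrix l l ℂ := diagonal d with hJ
  have hd1 : ∀ i, ‖d i‖ ≤ 1 := fun i => by simp only [hd]; split_ifs <;> simp
  have hJJ : J * J = J := by
    rw [hJ, diagonal_mul_diagonal]; congr 1; ext i; simp [hd]
  have hJh : Jᴴ = J := by
    rw [hJ, diagonal_conjTranspose]; congr 1; ext i; simp only [hd, Pi.star_apply]
    split_ifs <;> simp
  have hJS : J * S = S := by
    rw [hJ, hS, diagonal_mul_diagonal]; congr 1; ext i; simp only [hd]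
    split_ifs with h <;> simp [h]
  set P : Matrix m m ℂ := U * J * Uᴴ with hP
  set Q : Matrix m' m' ℂ := V * J * Vᴴ with hQ
  set E : Matrix m m' ℂ := U * J * Vᴴ with hE
  set Z : Matrix m m' ℂ := U * S * Vᴴ with hZ
  have hPP : P * P = P := by
    simp only [hP, Matrix.mul_assoc, mul_mul_cancel_of_isometry hU, mul_mul_of_mul_eq hJJ]
  have hQQ : Q * Q = Q := by
    simp only [hQ, Matrix.mul_assoc, mul_mul_cancel_of_isometry hV, mul_mul_of_mul_eq hJJ]
  have hPh : Pᴴ = P := by simp [hP, hJh, Matrix.mul_assoc]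
  have hQh : Qᴴ = Q := by simp [hQ, hJh, Matrix.mul_assoc]
  have hPE : P * E = E := by
    simp only [hP, hE, Matrix.mul_assoc, mul_mul_cancel_of_isometry hU, mul_mul_of_mul_eq hJJ]
  have hEQ : E * Q = E := by
    simp only [hQ, hE, Matrix.mul_assoc, mul_mul_cancel_of_isometry hV, mul_mul_of_mul_eq hJJ]
  have hPZ : P * Z = Z := by
    simp only [hP, hZ, Matrix.mul_assoc, mul_mul_cancel_of_isometry hU]
    rw [mul_mul_of_mul_eq hJS]
  have hP1 : P * (1 - P) = 0 := by rw [Matrix.mul_sub, hPP, Matrix.mul_one, sub_self]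
  have h1P : (1 - P) * P = 0 := by rw [Matrix.sub_mul, hPP, Matrix.one_mul, sub_self]
  have hQ1 : Q * (1 - Q) = 0 := by rw [Matrix.mul_sub, hQQ, Matrix.mul_one, sub_self]
  have h1Q : (1 - Q) * Q = 0 := by rw [Matrix.sub_mul, hQQ, Matrix.one_mul, sub_self]
  have h1Ph : (1 - P)ᴴ = 1 - P := by rw [conjTranspose_sub, hPh, conjTranspose_one]
  have h1Qh : (1 - Q)ᴴ = 1 - Q := by rw [conjTranspose_sub, hQh, conjTranspose_one]
  have h1QQ : (1 - Q) * (1 - Q) = 1 - Q := by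
    rw [Matrix.mul_sub, h1Q, Matrix.mul_one, sub_zero]
  set R : Matrix m m' ℂ := (1 - P) * N * (1 - Q) with hR
  set T : Matrix m m' ℂ := (1 - P) * N * Q with hT
  have hRh : Rᴴ = (1 - Q) * (Nᴴ * (1 - P)) := by
    rw [hR, conjTranspose_mul, conjTranspose_mul, h1Ph, h1Qh]
  have hRP : Rᴴ * P = 0 := by rw [hRh, Matrix.mul_assoc, Matrix.mul_assoc, h1P]; simp
  have hQR : Q * Rᴴ = 0 := by rw [hRh, ← Matrix.mul_assoc, hQ1, Matrix.zero_mul]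
  have hsplit : N = P * N + (T + R) := by
    rw [hT, hR, ← Matrix.mul_add, add_sub_cancel, Matrix.mul_one, ← Matrix.add_mul,
      add_sub_cancel, Matrix.one_mul]
  have hTR : T + R = (1 - P) * N := by
    rw [hT, hR, ← Matrix.mul_add, add_sub_cancel, Matrix.mul_one]
  have hfN : frobSq N = frobSq (P * N) + (frobSq T + frobSq R) := by
    conv_lhs => rw [hsplit]
    rw [frobSq_add_of_conjTranspose_mul_eq_zero, ← frobSq_conjTranspose (T + R), conjTranspose_add,
      frobSq_add_of_conjTranspose_mul_eq_zero, frobSq_conjTranspose, frobSq_conjTranspose]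
    · rw [conjTranspose_conjTranspose, hT, Matrix.mul_assoc, hQR, Matrix.mul_zero]
    · rw [hTR, conjTranspose_mul, hPh, Matrix.mul_assoc, ← Matrix.mul_assoc P, hP1]; simp
  have hfP : ∀ {q : Type _} [Fintype q] (X : Matrix m q ℂ), frobSq (P * X) ≤ frobSq (Uᴴ * X) := by
    intro q _ X
    rw [hP, Matrix.mul_assoc, Matrix.mul_assoc, frobSq_mul_of_isometry hU]
    exact frobSq_diagonal_mul_le hd1 _
  have hf1P : ∀ X : Matrix m m' ℂ, frobSq ((1 - P) * X) ≤ frobSq X := by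
    intro X
    have h : frobSq (P * X + (1 - P) * X) = frobSq (P * X) + frobSq ((1 - P) * X) := by
      apply frobSq_add_of_conjTranspose_mul_eq_zero
      rw [conjTranspose_mul, hPh, Matrix.mul_assoc, ← Matrix.mul_assoc P, hP1]; simp
    rw [← Matrix.add_mul, add_sub_cancel, Matrix.one_mul] at h
    linarith [frobSq_nonneg (P * X)]
  have hfT : frobSq T ≤ frobSq (N * V) := by
    rw [hT, Matrix.mul_assoc]
    refine (hf1P _).trans ?_
    rw [← frobSq_conjTranspose, conjTranspose_mul, hQh, ← frobSq_conjTranspose (N * V),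
      conjTranspose_mul, hQ, Matrix.mul_assoc, Matrix.mul_assoc, frobSq_mul_of_isometry hV]
    exact frobSq_diagonal_mul_le hd1 _
  have hfE : frobSq E ≤ ρ := by
    rw [hE, Matrix.mul_assoc, frobSq_mul_of_isometry hU, ← frobSq_conjTranspose, conjTranspose_mul,
      conjTranspose_conjTranspose, hJh, frobSq_mul_of_isometry hV]
    refine le_trans (le_of_eq ?_) (Nat.cast_le.2 hρ)
    rw [Finset.card_filter, Nat.cast_sum, frobSq]
    refine Finset.sum_congr rfl fun i _ => ?_
    rw [Finset.sum_eq_single i]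
    · by_cases h : s i = 0 <;> simp [hJ, hd, h]
    · intro j _ hj; simp [hJ, diagonal_apply_ne _ hj.symm]
    · simp
  have hrho : (0 : ℝ) ≤ ρ := Nat.cast_nonneg _
  have hRbig : ρ * frobSq (P * N) < frobSq R := by
    have h1 := hfP N
    have h3 := mul_le_mul_of_nonneg_left h1 hrho
    have h4 := mul_nonneg hrho (frobSq_nonneg (N * V))
    nlinarith
  have hR0 : 0 < frobSq R :=
    lt_of_le_of_lt (mul_nonneg hrho (frobSq_nonneg _)) hRbig
  set c : ℝ := (Real.sqrt (frobSq R))⁻¹ with hc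
  have hc2 : c ^ 2 * frobSq R = 1 := by
    rw [hc, inv_pow, Real.sq_sqrt hR0.le, inv_mul_cancel₀ hR0.ne']
  have hcR : c * frobSq R = Real.sqrt (frobSq R) := by
    rw [hc, inv_mul_eq_div, Real.div_sqrt]
  have hcontr : ∀ x : Matrix m' Unit ℂ, frobSq ((E + (c : ℂ) • R) * x) ≤ frobSq x := by
    intro x
    have hER : Eᴴ * R = 0 := by
      rw [← hPE, conjTranspose_mul, hPh, Matrix.mul_assoc, hR, ← Matrix.mul_assoc P,
        ← Matrix.mul_assoc P, hP1]; simp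
    have h1 : frobSq ((E + (c : ℂ) • R) * x) = frobSq (E * x) + c ^ 2 * frobSq (R * x) := by
      rw [Matrix.add_mul, Matrix.smul_mul, frobSq_add_of_conjTranspose_mul_eq_zero, frobSq_smul]
      · simp
      · rw [conjTranspose_mul, Matrix.mul_smul, Matrix.mul_assoc, ← Matrix.mul_assoc Eᴴ, hER]; simp
    have h2 : frobSq (E * x) = frobSq (Q * x) := by
      rw [hE, hQ]
      simp only [Matrix.mul_assoc]
      rw [frobSq_mul_of_isometry hU, frobSq_mul_of_isometry hV]
    have h3 : frobSq (R * x) ≤ frobSq R * frobSq ((1 - Q) * x) := by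
      have : R * x = R * ((1 - Q) * x) := by
        rw [← Matrix.mul_assoc, hR, Matrix.mul_assoc _ (1 - Q) (1 - Q), h1QQ]
      rw [this]
      exact frobSq_mul_le _ _
    have h4 : frobSq x = frobSq (Q * x) + frobSq ((1 - Q) * x) := by
      rw [← frobSq_add_of_conjTranspose_mul_eq_zero, ← Matrix.add_mul, add_sub_cancel,
        Matrix.one_mul]
      rw [conjTranspose_mul, hQh, Matrix.mul_assoc, ← Matrix.mul_assoc Q, hQ1]; simp
    rw [h1, h2, h4]
    have h5 := mul_le_mul_of_nonneg_left h3 (sq_nonneg c)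
    rw [← mul_assoc, hc2, one_mul] at h5
    linarith
  have hdual := re_trace_le_nuclearNorm (Z + N) _ hcontr
  have hEZ : (Eᴴ * Z).trace = ∑ i, (s i : ℂ) := by
    have : Eᴴ * Z = V * (S * Vᴴ) := by
      rw [hE, hZ]
      simp only [conjTranspose_mul, conjTranspose_conjTranspose, hJh, Matrix.mul_assoc,
        mul_mul_cancel_of_isometry hU]
      rw [mul_mul_of_mul_eq hJS]
    rw [this, trace_mul_comm, Matrix.mul_assoc, hV, Matrix.mul_one, hS, trace_diagonal]
  have hRZ : (Rᴴ * Z).trace = 0 := by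
    rw [← hPZ, ← Matrix.mul_assoc, hRP, Matrix.zero_mul, trace_zero]
  have hRN : (Rᴴ * N).trace.re = frobSq R := by
    rw [hsplit, Matrix.mul_add, Matrix.mul_add, ← Matrix.mul_assoc, hRP, Matrix.zero_mul, zero_add,
      trace_add, hT, trace_mul_comm, Matrix.mul_assoc, hQR, Matrix.mul_zero, trace_zero, zero_add,
      trace_conjTranspose_mul_self_re]
  have hEN : (Eᴴ * N).trace.re = (Eᴴ * (P * N)).trace.re := by
    rw [← Matrix.mul_assoc]
    conv_lhs => rw [← hPE]
    rw [conjTranspose_mul, hPh]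
  have hcs : -Real.sqrt (frobSq R) < (Eᴴ * N).trace.re := by
    rw [hEN]
    have h := re_trace_sq_le E (P * N)
    have h' := mul_le_mul_of_nonneg_right hfE (frobSq_nonneg (P * N))
    exact (abs_lt.1 (Real.lt_sqrt_of_sq_lt (by rw [sq_abs]; exact (h.trans h').trans_lt hRbig))).1
  have hexp : ((E + (c : ℂ) • R)ᴴ * (Z + N)).trace.re =
      (∑ i, s i) + (Eᴴ * N).trace.re + Real.sqrt (frobSq R) := by
    rw [conjTranspose_add, conjTranspose_smul, Matrix.add_mul, Matrix.mul_add, Matrix.smul_mul,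
      Matrix.mul_add, trace_add, trace_add, trace_smul, trace_add, hRZ, hEZ, zero_add]
    simp only [Complex.add_re, Complex.re_sum, Complex.ofReal_re, Complex.star_def,
      Complex.conj_ofReal, smul_eq_mul, Complex.re_ofReal_mul, hRN, hcR]
  have hup := nuclearNorm_mul_diagonal_mul_le hU hV hs
  rw [hexp] at hdual
  linarith

end NuclearNorm

section Character

theorem sum_exp_fin (N : ℕ) [NeZero N] (l : Fin N) :
    ∑ a : Fin N, Complex.exp (-(2 * Real.pi * Complex.I) *
      (((a : ℕ) : ℂ) * ((l : ℕ) : ℂ) / (N : ℂ))) = if l = 0 then (N : ℂ) else 0 := by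
  have hN : (N : ℂ) ≠ 0 := Nat.cast_ne_zero.2 (NeZero.ne N)
  split_ifs with h
  · subst h; simp
  set ζ : ℂ := Complex.exp (-(2 * Real.pi * Complex.I) * (((l : ℕ) : ℂ) / (N : ℂ))) with hζ
  have hterm : ∀ a : ℕ, Complex.exp (-(2 * Real.pi * Complex.I) *
      ((a : ℂ) * ((l : ℕ) : ℂ) / (N : ℂ))) = ζ ^ a := fun a => by
    rw [hζ, ← Complex.exp_nat_mul]; congr 1; ring
  simp only [hterm]
  rw [← Finset.sum_range (fun a => ζ ^ a)]
  have hζN : ζ ^ N = 1 := by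
    rw [← hterm N, Complex.exp_eq_one_iff]
    refine ⟨-((l : ℕ) : ℤ), ?_⟩
    push_cast
    field_simp
  have hζ1 : ζ ≠ 1 := by
    intro h1
    obtain ⟨q, hq⟩ := Complex.exp_eq_one_iff.1 h1
    have h2 : ((l : ℕ) : ℂ) = -(q : ℂ) * N := by
      field_simp at hq
      linear_combination -hq
    have h3 : ((l : ℕ) : ℤ) = -q * N := by exact_mod_cast h2
    have h4 : (N : ℤ) ∣ ((l : ℕ) : ℤ) := ⟨-q, by rw [h3]; ring⟩
    have h5 : N ∣ (l : ℕ) := by exact_mod_cast h4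
    exact h (Fin.ext (Nat.eq_zero_of_dvd_of_lt h5 l.2))
  have := mul_neg_geom_sum ζ N
  rw [hζN, sub_self] at this
  exact (mul_eq_zero.1 this).resolve_left (sub_ne_zero.2 (Ne.symm hζ1))

theorem exp_fin_add {N : ℕ} [NeZero N] (f : ℕ) (l m : Fin N) :
    Complex.exp (-(2 * Real.pi * Complex.I) * ((f : ℂ) * (((l + m : Fin N) : ℕ) : ℂ) / (N : ℂ))) =
      Complex.exp (-(2 * Real.pi * Complex.I) * ((f : ℂ) * ((l : ℕ) : ℂ) / (N : ℂ))) *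
        Complex.exp (-(2 * Real.pi * Complex.I) * ((f : ℂ) * ((m : ℕ) : ℂ) / (N : ℂ))) := by
  have hN : (N : ℂ) ≠ 0 := Nat.cast_ne_zero.2 (NeZero.ne N)
  rw [← Complex.exp_add, Complex.exp_eq_exp_iff_exists_int, Fin.val_add]
  have h := congrArg (Nat.cast : ℕ → ℂ) (Nat.mod_add_div ((l : ℕ) + (m : ℕ)) N)
  generalize ((l : ℕ) + (m : ℕ)) / N = q at h
  refine ⟨(f : ℤ) * (q : ℤ), ?_⟩
  push_cast at h
  push_cast
  field_simp
  linear_combination (-(f : ℂ)) * h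

variable {p : ℕ} {n : Fin p → ℕ}

/-- The Fourier character at frequency `f`. -/
def chi (f l : Idx n) : ℂ :=
  Complex.exp (-(2 * Real.pi * Complex.I) *
      ∑ s : Fin p, ((f s : ℕ) : ℂ) * ((l s : ℕ) : ℂ) / ((n s : ℕ) : ℂ))

theorem chi_eq_prod (f l : Idx n) :
    chi f l = ∏ s, Complex.exp (-(2 * Real.pi * Complex.I) *
      (((f s : ℕ) : ℂ) * ((l s : ℕ) : ℂ) / ((n s : ℕ) : ℂ))) := by
  rw [chi, Finset.mul_sum, Complex.exp_sum]

theorem norm_chi (f l : Idx n) : ‖chi f l‖ = 1 := by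
  have h : chi f l = Complex.exp (((-(2 * Real.pi) *
      ∑ s : Fin p, ((f s : ℕ) : ℝ) * ((l s : ℕ) : ℝ) / ((n s : ℕ) : ℝ) : ℝ) : ℂ) * Complex.I) := by
    rw [chi]; congr 1; push_cast; ring
  rw [h, Complex.norm_exp_ofReal_mul_I]

variable [∀ j, NeZero (n j)]

theorem chi_add (f l m : Idx n) : chi f (l + m) = chi f l * chi f m := by
  simp only [chi_eq_prod, ← Finset.prod_mul_distrib]
  exact Finset.prod_congr rfl fun s _ => exp_fin_add _ _ _

theorem chi_zero (f : Idx n) : chi f 0 = 1 := by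
  simp [chi]

theorem chi_neg (f l : Idx n) : chi f (-l) = star (chi f l) := by
  have h : chi f (-l) * chi f l = 1 := by rw [← chi_add, neg_add_cancel, chi_zero]
  have h2 : star (chi f l) * chi f l = 1 := by
    rw [Complex.star_def, ← Complex.normSq_eq_conj_mul_self, Complex.normSq_eq_norm_sq, norm_chi]
    simp
  have h0 : chi f l ≠ 0 := Complex.exp_ne_zero _
  exact mul_right_cancel₀ h0 (h.trans h2.symm)

theorem sum_chi (l : Idx n) : ∑ f, chi f l = if l = 0 then ((∏ j, n j : ℕ) : ℂ) else 0 := by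
  simp only [chi_eq_prod]
  have h := (Finset.prod_univ_sum (fun s : Fin p => (Finset.univ : Finset (Fin (n s))))
    (fun s a => Complex.exp (-(2 * Real.pi * Complex.I) *
      (((a : ℕ) : ℂ) * ((l s : ℕ) : ℂ) / ((n s : ℕ) : ℂ))))).symm
  rw [Fintype.piFinset_univ] at h
  rw [h]
  simp only [sum_exp_fin]
  split_ifs with h0
  · subst h0; simp
  · obtain ⟨s, hs⟩ := Function.ne_iff.1 h0
    exact Finset.prod_eq_zero (Finset.mem_univ s) (if_neg hs)

/-- Parseval's identity for the unnormalized multidimensional discrete Fourier transform. -/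
theorem parseval (x : Idx n → ℝ) :
    ∑ f, ‖∑ l, chi f l * (x l : ℂ)‖ ^ 2 = ((∏ j, n j : ℕ) : ℝ) * ∑ l, x l ^ 2 := by
  apply Complex.ofReal_injective
  push_cast
  have h1 : ∀ f : Idx n, ((‖∑ l, chi f l * (x l : ℂ)‖ : ℝ) : ℂ) ^ 2 =
      ∑ l, ∑ m, ((x l : ℂ) * x m) * chi f (m - l) := by
    intro f
    rw [← Complex.ofReal_pow, ← Complex.normSq_eq_norm_sq, Complex.normSq_eq_conj_mul_self, map_sum,
      Finset.sum_mul_sum]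
    refine Finset.sum_congr rfl fun l _ => Finset.sum_congr rfl fun m _ => ?_
    rw [sub_eq_add_neg, chi_add, chi_neg, map_mul, Complex.conj_ofReal, Complex.star_def]
    ring
  simp only [h1]
  rw [Finset.sum_comm, Finset.mul_sum]
  refine Finset.sum_congr rfl fun l _ => ?_
  rw [Finset.sum_comm, Finset.sum_eq_single l]
  · rw [← Finset.mul_sum, sum_chi, if_pos (sub_self l)]
    push_cast; ring
  · intro m _ hm
    rw [← Finset.mul_sum, sum_chi, if_neg (sub_ne_zero.2 hm), mul_zero]
  · simp

end Character

section FourierFaces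

variable {p : ℕ} {n : Fin p → ℕ} {a b c : ℕ}

theorem faceF_apply (A : Tensor n a b) (f : Idx n) (i : Fin a) (j : Fin b) :
    faceF A f i j = ∑ l, chi f l * (A i j l : ℂ) := rfl

theorem faceF_add (A B : Tensor n a b) (f : Idx n) : faceF (A + B) f = faceF A f + faceF B f := by
  ext i j
  simp [faceF_apply, mul_add, Finset.sum_add_distrib]

variable [∀ j, NeZero (n j)]

theorem faceF_tprod (A : Tensor n a b) (B : Tensor n b c) (f : Idx n) :
    faceF (tprod A B) f = faceF A f * faceF B f := by
  ext i j
  simp only [faceF_apply, mul_apply, tprod, conv, Complex.ofReal_sum, Complex.ofReal_mul,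
    Finset.mul_sum, Finset.sum_mul]
  rw [Finset.sum_comm]
  refine Finset.sum_congr rfl fun m _ => ?_
  rw [Finset.sum_comm]
  conv_rhs => rw [Finset.sum_comm]
  refine Finset.sum_congr rfl fun q _ => ?_
  rw [← Equiv.sum_comp (Equiv.addRight q)]
  refine Finset.sum_congr rfl fun l _ => ?_
  rw [Equiv.coe_addRight, add_sub_cancel_right, chi_add]
  ring

theorem faceF_ttranspose (A : Tensor n a b) (f : Idx n) :
    faceF (ttranspose A) f = (faceF A f)ᴴ := by
  ext i j
  simp only [faceF_apply, conjTranspose_apply, ttranspose, star_sum, star_mul']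
  rw [← Equiv.sum_comp (Equiv.neg _)]
  refine Finset.sum_congr rfl fun l _ => ?_
  simp [chi_neg]

theorem faceF_idTensor (f : Idx n) : faceF (idTensor n a) f = 1 := by
  ext i j
  rw [faceF_apply, Finset.sum_eq_single 0]
  · by_cases hij : i = j <;> simp [idTensor, chi_zero, one_apply, hij]
  · intro l _ hl; simp [idTensor, hl]
  · simp

end FourierFaces

section BlockFourier

variable {p : ℕ} {n : Fin p → ℕ} {a b c : ℕ}

/-- The squared Frobenius norm of a tensor. -/
def tensorSq (A : Tensor n a b) : ℝ := ∑ i, ∑ j, ∑ l, A i j l ^ 2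

/-- The block-diagonal matrix of the Fourier-domain face slices. -/
def blockF (A : Tensor n a b) : Matrix (Fin a × Idx n) (Fin b × Idx n) ℂ :=
  blockDiagonal fun f => faceF A f

theorem blockF_add (A B : Tensor n a b) : blockF (A + B) = blockF A + blockF B := by
  simp only [blockF, faceF_add]
  exact blockDiagonal_add _ _

theorem blockF_eq_diagonal {S : Tensor n a a} (hS : FDiagonal S) (hS' : OrderedDiagonal S) :
    blockF S = diagonal fun x : Fin a × Idx n => (((faceF S x.2 x.1 x.1).re : ℝ) : ℂ) := by
  rw [← blockDiagonal_diagonal (fun f i => (((faceF S f i i).re : ℝ) : ℂ)), blockF]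
  congr 1
  funext f
  ext i j
  by_cases hij : i = j
  · subst hij
    rw [diagonal_apply_eq]
    exact Complex.ext rfl (by simp [((hS' f).1 i i rfl).1])
  · rw [diagonal_apply_ne _ hij, faceF_apply]
    refine Finset.sum_eq_zero fun l _ => ?_
    rw [hS i j (fun h => hij (Fin.ext h))]; simp

variable [∀ j, NeZero (n j)]

theorem blockF_tprod (A : Tensor n a b) (B : Tensor n b c) :
    blockF (tprod A B) = blockF A * blockF B := by
  simp only [blockF, faceF_tprod]
  exact blockDiagonal_mul _ _

theorem blockF_ttranspose (A : Tensor n a b) : blockF (ttranspose A) = (blockF A)ᴴ := by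
  simp only [blockF, faceF_ttranspose]
  exact (blockDiagonal_conjTranspose _).symm

theorem blockF_idTensor : blockF (idTensor n a) = 1 := by
  simp only [blockF, faceF_idTensor]
  exact blockDiagonal_one

theorem frobSq_blockF (A : Tensor n a b) :
    frobSq (blockF A) = ((∏ j, n j : ℕ) : ℝ) * tensorSq A := by
  have h : ∀ (i : Fin a) (f : Idx n), ∑ y : Fin b × Idx n, ‖blockF A (i, f) y‖ ^ 2 =
      ∑ j, ‖faceF A f i j‖ ^ 2 := by
    intro i f
    rw [Fintype.sum_prod_type]
    refine Finset.sum_congr rfl fun j _ => ?_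
    rw [Finset.sum_eq_single f]
    · rw [blockF, blockDiagonal_apply_eq]
    · intro g _ hg
      rw [blockF, blockDiagonal_apply_ne _ _ _ hg.symm]; simp
    · simp
  rw [frobSq, Fintype.sum_prod_type, tensorSq, Finset.mul_sum]
  refine Finset.sum_congr rfl fun i _ => ?_
  simp only [h]
  rw [Finset.sum_comm, Finset.mul_sum]
  exact Finset.sum_congr rfl fun j _ => parseval _

theorem card_singularValue_ne_zero_le {Z : Tensor n a b} {U : Tensor n a c} {S : Tensor n c c}
    {V : Tensor n b c} (h : IsSkinnyTSVD Z U S V) :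
    (Finset.univ.filter fun x : Fin c × Idx n => (faceF S x.2 x.1 x.1).re ≠ 0).card ≤
      multiRankSum Z := by
  obtain ⟨hU, hV, hS, hS', hZ⟩ := h
  have hcard : (Finset.univ.filter fun x : Fin c × Idx n => (faceF S x.2 x.1 x.1).re ≠ 0).card =
      ∑ f : Idx n, (Finset.univ.filter fun i : Fin c => (faceF S f i i).re ≠ 0).card := by
    simp only [Finset.card_filter]
    rw [Fintype.sum_prod_type, Finset.sum_comm]
  rw [hcard, multiRankSum]
  refine Finset.sum_le_sum fun f _ => ?_
  have hUf : (faceF U f)ᴴ * faceF U f = 1 := by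
    rw [← faceF_ttranspose, ← faceF_tprod, hU, faceF_idTensor]
  have hVf : (faceF V f)ᴴ * faceF V f = 1 := by
    rw [← faceF_ttranspose, ← faceF_tprod, hV, faceF_idTensor]
  have hSf : faceF S f = diagonal fun i => (((faceF S f i i).re : ℝ) : ℂ) := by
    have := congrArg (fun B i j => B (i, f) (j, f)) (blockF_eq_diagonal hS hS')
    ext i j
    have h2 := congrFun (congrFun this i) j
    simp only [blockF, blockDiagonal_apply_eq] at h2
    rw [h2]
    by_cases hij : i = j
    · subst hij; simp
    · rw [diagonal_apply_ne _ hij, diagonal_apply_ne _ (by simpa using hij)]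
  have hZf : faceF S f = (faceF U f)ᴴ * faceF Z f * faceF V f := by
    rw [hZ, faceF_tprod, faceF_tprod, faceF_ttranspose]
    simp only [Matrix.mul_assoc, mul_mul_cancel_of_isometry hUf, hVf, Matrix.mul_one]
  have hr : (faceF S f).rank ≤ multiRank Z f := by
    rw [hZf]
    exact (rank_mul_le_left _ _).trans (rank_mul_le_right _ _)
  rw [hSf, rank_diagonal, Fintype.card_subtype] at hr
  simpa using hr

/-- A perturbation that is nearly orthogonal to the singular tensor spaces strictly increases the
tensor nuclear norm. -/
theorem tensorNuclearNorm_lt_add {Z : Tensor n a b} {U : Tensor n a c} {S : Tensor n c c}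
    {V : Tensor n b c} (h : IsSkinnyTSVD Z U S V) (N : Tensor n a b)
    (hN : ((multiRankSum Z : ℝ) + 1) * (tensorSq (tprod (ttranspose U) N) +
      tensorSq (tprod (ttranspose V) (ttranspose N))) < tensorSq N) :
    tensorNuclearNorm Z < tensorNuclearNorm (Z + N) := by
  have hcard := card_singularValue_ne_zero_le h
  obtain ⟨hU, hV, hS, hS', hZ⟩ := h
  have hn : (0 : ℝ) < ((∏ j, n j : ℕ) : ℝ) :=
    Nat.cast_pos.2 (Finset.prod_pos fun j _ => Nat.pos_of_ne_zero (NeZero.ne (n j)))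
  have hUb : (blockF U)ᴴ * blockF U = 1 := by
    rw [← blockF_ttranspose, ← blockF_tprod, hU, blockF_idTensor]
  have hVb : (blockF V)ᴴ * blockF V = 1 := by
    rw [← blockF_ttranspose, ← blockF_tprod, hV, blockF_idTensor]
  have hZb : blockF Z = blockF U *
      diagonal (fun x : Fin c × Idx n => (((faceF S x.2 x.1 x.1).re : ℝ) : ℂ)) * (blockF V)ᴴ := by
    rw [← blockF_eq_diagonal hS hS', ← blockF_ttranspose, ← blockF_tprod, ← blockF_tprod, ← hZ]
  have key := nuclearNorm_lt_nuclearNorm_add hUb hVb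
    (s := fun x : Fin c × Idx n => (faceF S x.2 x.1 x.1).re)
    (fun x => ((hS' x.2).1 x.1 x.1 rfl).2) hcard (blockF N) (by
      have h1 : frobSq (blockF N * blockF V) =
          frobSq (blockF (tprod (ttranspose V) (ttranspose N))) := by
        rw [blockF_tprod, blockF_ttranspose, blockF_ttranspose, ← conjTranspose_mul,
          frobSq_conjTranspose]
      rw [h1, ← blockF_ttranspose, ← blockF_tprod, frobSq_blockF, frobSq_blockF, frobSq_blockF,
        ← mul_add, mul_left_comm]
      exact mul_lt_mul_of_pos_left hN hn)
  rw [← hZb, ← blockF_add] at key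
  exact mul_lt_mul_of_pos_left key (one_div_pos.2 hn)

end BlockFourier

section Counting

variable {p : ℕ} {n : Fin p → ℕ} {a b c : ℕ}

theorem tensorSq_ttranspose (A : Tensor n a b) : tensorSq (ttranspose A) = tensorSq A := by
  simp only [tensorSq, ttranspose]
  rw [Finset.sum_comm]
  refine Finset.sum_congr rfl fun i _ => Finset.sum_congr rfl fun j _ => ?_
  exact Equiv.sum_comp (Equiv.neg _) (fun l => A i j l ^ 2)

variable [∀ j, NeZero (n j)]

theorem tprod_ttranspose_colBasis (W : Tensor n a c) (i : Fin a) (m : Fin c) (j : Fin 1)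
    (l : Idx n) : tprod (ttranspose W) (colBasis n i) m j l = W i m (-l) := by
  simp only [tprod, conv, ttranspose, colBasis]
  rw [Finset.sum_eq_single i, Finset.sum_eq_single l]
  · simp
  · intro q _ hq
    rw [if_neg, mul_zero]
    rintro ⟨-, h⟩
    exact hq (sub_eq_zero.1 h).symm
  · simp
  · intro i' _ hi'
    simp [hi']
  · simp

theorem tensorSq_tprod_ttranspose_colBasis (W : Tensor n a c) (i : Fin a) :
    tensorSq (tprod (ttranspose W) (colBasis n i)) = ∑ m, ∑ l, W i m l ^ 2 := by
  simp only [tensorSq, tprod_ttranspose_colBasis, Finset.univ_unique, Finset.sum_singleton]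
  refine Finset.sum_congr rfl fun m _ => ?_
  exact Equiv.sum_comp (Equiv.neg _) (fun l => W i m l ^ 2)

theorem tprod_ttranspose_apply (W : Tensor n a c) (Q : Tensor n a b) (m : Fin c) (j : Fin b)
    (l : Idx n) :
    tprod (ttranspose W) Q m j l = ∑ x : Fin a × Idx n, Q x.1 j x.2 * W x.1 m (x.2 - l) := by
  rw [Fintype.sum_prod_type]
  refine Finset.sum_congr rfl fun i _ => ?_
  rw [conv, ← Equiv.sum_comp (Equiv.subLeft l)]
  refine Finset.sum_congr rfl fun q _ => ?_
  simp only [Equiv.subLeft_apply, ttranspose, sub_sub_cancel, neg_sub]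
  ring

/-- Projecting a tensor with sparse columns onto an incoherent tensor space shrinks it. -/
theorem tensorSq_tprod_ttranspose_le (W : Tensor n a c) (Q : Tensor n a b) {κ : ℝ} {C : ℕ}
    (hQ : ∀ j, (Finset.univ.filter fun x : Fin a × Idx n => Q x.1 j x.2 ≠ 0).card ≤ C)
    (hW : ∀ i, tensorSq (tprod (ttranspose W) (colBasis n i)) ≤ κ) :
    tensorSq (tprod (ttranspose W) Q) ≤ C * κ * tensorSq Q := by
  have hcol : ∀ m j l, tprod (ttranspose W) Q m j l ^ 2 ≤
      C * ∑ x : Fin a × Idx n, Q x.1 j x.2 ^ 2 * W x.1 m (x.2 - l) ^ 2 := by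
    intro m j l
    set K := Finset.univ.filter fun x : Fin a × Idx n => Q x.1 j x.2 ≠ 0 with hK
    have h : ∑ x : Fin a × Idx n, Q x.1 j x.2 * W x.1 m (x.2 - l) =
        ∑ x ∈ K, Q x.1 j x.2 * W x.1 m (x.2 - l) := by
      refine (Finset.sum_subset (Finset.subset_univ _) fun x _ hx => ?_).symm
      have : Q x.1 j x.2 = 0 := by simpa [hK] using hx
      rw [this, zero_mul]
    rw [tprod_ttranspose_apply, h]
    refine sq_sum_le_card_mul_sum_sq.trans ?_
    simp only [mul_pow]
    refine mul_le_mul (Nat.cast_le.2 (hQ j)) ?_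
      (Finset.sum_nonneg fun _ _ => by positivity) (Nat.cast_nonneg _)
    exact Finset.sum_le_sum_of_subset_of_nonneg (Finset.subset_univ _) fun _ _ _ => by positivity
  have hQsq : tensorSq Q = ∑ j, ∑ x : Fin a × Idx n, Q x.1 j x.2 ^ 2 := by
    simp only [tensorSq, Fintype.sum_prod_type]
    exact Finset.sum_comm
  have hshift : ∀ x : Fin a × Idx n, ∑ m, ∑ l, W x.1 m (x.2 - l) ^ 2 ≤ κ := by
    intro x
    refine le_trans (le_of_eq ?_) (hW x.1)
    rw [tensorSq_tprod_ttranspose_colBasis]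
    exact Finset.sum_congr rfl fun m _ =>
      Equiv.sum_comp (Equiv.subLeft x.2) (fun l => W x.1 m l ^ 2)
  calc tensorSq (tprod (ttranspose W) Q)
      ≤ ∑ m, ∑ j, ∑ l, C * ∑ x : Fin a × Idx n, Q x.1 j x.2 ^ 2 * W x.1 m (x.2 - l) ^ 2 :=
        Finset.sum_le_sum fun m _ => Finset.sum_le_sum fun j _ => Finset.sum_le_sum fun l _ =>
          hcol m j l
    _ = C * ∑ j, ∑ x : Fin a × Idx n, Q x.1 j x.2 ^ 2 * ∑ m, ∑ l, W x.1 m (x.2 - l) ^ 2 := by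
        rw [Finset.sum_comm, Finset.mul_sum]
        refine Finset.sum_congr rfl fun j _ => ?_
        simp only [← Finset.mul_sum]
        congr 1
        simp only [Finset.mul_sum]
        conv_rhs => rw [Finset.sum_comm]
        refine Finset.sum_congr rfl fun m _ => ?_
        exact Finset.sum_comm
    _ ≤ C * ∑ j, ∑ x : Fin a × Idx n, Q x.1 j x.2 ^ 2 * κ := by
        refine mul_le_mul_of_nonneg_left ?_ (Nat.cast_nonneg _)
        exact Finset.sum_le_sum fun j _ => Finset.sum_le_sum fun x _ =>
          mul_le_mul_of_nonneg_left (hshift x) (sq_nonneg _)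
    _ = C * κ * tensorSq Q := by
        rw [hQsq]
        simp only [← Finset.sum_mul]
        ring

end Counting

section Hankel

variable {p : ℕ} {n : Fin p → ℕ} {t k : ℕ}

theorem hankel_add (X Y : Series n t) : hankel k (X + Y) = hankel k X + hankel k Y := by
  funext i j l
  exact mul_add _ _ _

theorem tensorSq_hankel_pos (hk : 1 ≤ k) {D : Series n t} (hD : D ≠ 0) :
    0 < tensorSq (hankel k D) := by
  obtain ⟨i, hi⟩ := Function.ne_iff.1 hD
  obtain ⟨l, hl⟩ := Function.ne_iff.1 hi
  have hpos : 0 < hankel k D i ⟨0, hk⟩ l ^ 2 := by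
    have h : hankel k D i ⟨0, hk⟩ l = 1 / Real.sqrt k * D i l := by
      simp [hankel, Nat.mod_eq_of_lt i.2]
    have hk' : (0 : ℝ) < Real.sqrt k := Real.sqrt_pos.2 (Nat.cast_pos.2 hk)
    rw [h]
    exact sq_pos_of_ne_zero (mul_ne_zero (one_div_pos.2 hk').ne' hl)
  refine hpos.trans_le ?_
  refine (Finset.single_le_sum (f := fun l => hankel k D i ⟨0, hk⟩ l ^ 2)
    (fun _ _ => sq_nonneg _) (Finset.mem_univ l)).trans ?_
  refine (Finset.single_le_sum (f := fun j => ∑ l, hankel k D i j l ^ 2)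
    (fun _ _ => Finset.sum_nonneg fun _ _ => sq_nonneg _) (Finset.mem_univ _)).trans ?_
  exact Finset.single_le_sum (f := fun i => ∑ j, ∑ l, hankel k D i j l ^ 2)
    (fun _ _ => Finset.sum_nonneg fun _ _ => Finset.sum_nonneg fun _ _ => sq_nonneg _)
    (Finset.mem_univ i)

theorem notMem_of_hankel_ne_zero {Ω : Finset (Fin t × Idx n)} {D : Series n t}
    (hD : ∀ x ∈ Ω, D x.1 x.2 = 0) {i : Fin t} {j : Fin k} {l : Idx n}
    (h : hankel k D i j l ≠ 0) :
    ((⟨((i : ℕ) + (j : ℕ)) % t, Nat.mod_lt _ i.pos⟩, l) : Fin t × Idx n) ∉ Ω := fun hx =>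
  h (by rw [hankel, hD _ hx, mul_zero])

theorem card_hankel_column_le {Ω : Finset (Fin t × Idx n)} {D : Series n t}
    (hD : ∀ x ∈ Ω, D x.1 x.2 = 0) (j : Fin k) :
    (Finset.univ.filter fun x : Fin t × Idx n => hankel k D x.1 j x.2 ≠ 0).card ≤ Ωᶜ.card := by
  refine Finset.card_le_card_of_injOn
    (fun x => (⟨((x.1 : ℕ) + (j : ℕ)) % t, Nat.mod_lt _ x.1.pos⟩, x.2)) ?_ ?_
  · intro x hx
    rw [Finset.mem_coe, Finset.mem_compl]
    exact notMem_of_hankel_ne_zero hD (Finset.mem_filter.1 hx).2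
  · rintro ⟨i, l⟩ - ⟨i', l'⟩ - h
    simp only [Prod.mk.injEq, Fin.mk.injEq] at h
    have h1 : (i : ℕ) ≡ i' [MOD t] := Nat.ModEq.add_right_cancel' (j : ℕ) h.1
    exact Prod.ext (Fin.ext (Nat.ModEq.eq_of_lt_of_lt h1 i.2 i'.2)) h.2

theorem card_hankel_row_le (hkt : k ≤ t) {Ω : Finset (Fin t × Idx n)} {D : Series n t}
    (hD : ∀ x ∈ Ω, D x.1 x.2 = 0) (i : Fin t) :
    (Finset.univ.filter fun x : Fin k × Idx n =>
      ttranspose (hankel k D) x.1 i x.2 ≠ 0).card ≤ Ωᶜ.card := by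
  refine Finset.card_le_card_of_injOn
    (fun x => (⟨((i : ℕ) + (x.1 : ℕ)) % t, Nat.mod_lt _ i.pos⟩, -x.2)) ?_ ?_
  · intro x hx
    rw [Finset.mem_coe, Finset.mem_compl]
    exact notMem_of_hankel_ne_zero hD (Finset.mem_filter.1 hx).2
  · rintro ⟨j, l⟩ - ⟨j', l'⟩ - h
    simp only [Prod.mk.injEq, Fin.mk.injEq, neg_inj] at h
    have h1 : (j : ℕ) ≡ j' [MOD t] := Nat.ModEq.add_left_cancel' (i : ℕ) h.1
    exact Prod.ext (Fin.ext
      (Nat.ModEq.eq_of_lt_of_lt h1 (j.2.trans_le hkt) (j'.2.trans_le hkt))) h.2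

variable [∀ j, NeZero (n j)]

theorem card_compl_le (ht : 0 < t) (Ω : Finset (Fin t × Idx n)) :
    (Ωᶜ.card : ℝ) ≤ ((∏ j, n j : ℕ) : ℝ) * (t * (1 - samplingRate Ω)) := by
  have ht' : (0 : ℝ) < t := Nat.cast_pos.2 ht
  have hcard : (Ω.card : ℝ) = ∑ l, (samplingNumber Ω l : ℝ) := by
    rw [← Nat.cast_sum]
    congr 1
    simp only [samplingNumber, Finset.card_filter]
    rw [Finset.sum_comm, ← Fintype.sum_prod_type (fun x : Fin t × Idx n => if x ∈ Ω then 1 else 0)]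
    simp
  have hlow : ∀ l, t * samplingRate Ω ≤ samplingNumber Ω l := by
    intro l
    have h : samplingRate Ω ≤ (samplingNumber Ω l : ℝ) / t :=
      Finset.inf'_le _ (Finset.mem_univ l)
    rw [le_div_iff₀ ht'] at h
    linarith
  have hsum := Finset.sum_le_sum fun l (_ : l ∈ (Finset.univ : Finset (Idx n))) => hlow l
  have hidx : Fintype.card (Idx n) = ∏ j, n j := by simp [Idx]
  rw [Finset.sum_const, Finset.card_univ, nsmul_eq_mul, hidx, ← hcard] at hsum
  have htot : (Ωᶜ.card : ℝ) + Ω.card = t * ((∏ j, n j : ℕ) : ℝ) := by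
    rw [← Nat.cast_add, add_comm, Finset.card_add_card_compl, Fintype.card_prod, Fintype.card_fin,
      hidx, Nat.cast_mul]
  linarith

/-- Under the sampling condition, every other feasible series has a strictly larger temporal
Hankel nuclear norm. -/
theorem tensorNuclearNorm_hankel_lt {M X : Series n t} {μ : ℝ} {r : ℕ} (hk : 1 ≤ k) (hkt : k ≤ t)
    (hμ : 0 < μ) (hM : HankelIncoherent k μ r M) {Ω : Finset (Fin t × Idx n)}
    (hΩ : r ≠ 0 → samplingRate Ω >
      1 - (k : ℝ) / (2 * μ * r * ((multiRankSum (hankel k M) : ℝ) + 1) * t))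
    (hX : sample Ω X = sample Ω M) (hne : X ≠ M) :
    tensorNuclearNorm (hankel k M) < tensorNuclearNorm (hankel k X) := by
  obtain ⟨-, U, S, V, hsvd, hU, hV⟩ := hM
  have hsplit : X = M + (X - M) := (add_sub_cancel _ _).symm
  have hD0 : X - M ≠ 0 := sub_ne_zero.2 hne
  have hD : ∀ x ∈ Ω, (X - M) x.1 x.2 = 0 := by
    intro x hx
    have h := congrFun (congrFun hX x.1) x.2
    simp only [sample, Prod.mk.eta, if_pos hx] at h
    simp [h]
  have hpos := tensorSq_hankel_pos hk hD0
  rw [hsplit, hankel_add]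
  refine tensorNuclearNorm_lt_add hsvd _ ?_
  have ht : 0 < t := hk.trans hkt
  have ht' : (0 : ℝ) < t := Nat.cast_pos.2 ht
  have hk' : (0 : ℝ) < k := Nat.cast_pos.2 hk
  have hkt' : (k : ℝ) ≤ t := Nat.cast_le.2 hkt
  have hn : (0 : ℝ) < ((∏ j, n j : ℕ) : ℝ) :=
    Nat.cast_pos.2 (Finset.prod_pos fun j _ => Nat.pos_of_ne_zero (NeZero.ne (n j)))
  have hcompl := card_compl_le ht Ω
  set ν : ℝ := ((∏ j, n j : ℕ) : ℝ)
  set R : ℝ := (multiRankSum (hankel k M) : ℝ)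
  set C : ℝ := (Ωᶜ.card : ℝ)
  have hR : 0 < R + 1 := by positivity
  have hr0 : (0 : ℝ) ≤ r := Nat.cast_nonneg r
  have hUκ : ∀ i, tensorSq (tprod (ttranspose U) (colBasis n i)) ≤ μ * r / (t * ν) := fun i =>
    (Real.sqrt_le_sqrt_iff (by positivity)).1 (hU i)
  have hVκ : ∀ i, tensorSq (tprod (ttranspose V) (colBasis n i)) ≤ μ * r / (k * ν) := fun i =>
    (Real.sqrt_le_sqrt_iff (by positivity)).1 (hV i)
  have h1 := tensorSq_tprod_ttranspose_le U (hankel k (X - M)) (card_hankel_column_le hD) hUκ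
  have h2 := tensorSq_tprod_ttranspose_le V (ttranspose (hankel k (X - M)))
    (card_hankel_row_le hkt hD) hVκ
  rw [tensorSq_ttranspose] at h2
  have hsmall : (R + 1) * (C * (μ * r / (t * ν)) + C * (μ * r / (k * ν))) < 1 := by
    by_cases hr : r = 0
    · simp [hr]
    have hrp : (0 : ℝ) < r := Nat.cast_pos.2 (Nat.pos_of_ne_zero hr)
    have hρ := hΩ hr
    have hC0 : 0 ≤ C := Nat.cast_nonneg _
    have hC : C < ν * (k / (2 * μ * r * (R + 1))) := by
      refine hcompl.trans_lt (mul_lt_mul_of_pos_left ?_ hn)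
      calc (t : ℝ) * (1 - samplingRate Ω) < t * (k / (2 * μ * r * (R + 1) * t)) :=
            mul_lt_mul_of_pos_left (by linarith) ht'
        _ = _ := by field_simp
    have hmono : μ * r / (t * ν) ≤ μ * r / (k * ν) :=
      div_le_div_of_nonneg_left (mul_nonneg hμ.le hr0) (mul_pos hk' hn)
        (mul_le_mul_of_nonneg_right hkt' hn.le)
    calc (R + 1) * (C * (μ * r / (t * ν)) + C * (μ * r / (k * ν)))
        ≤ (R + 1) * (C * (μ * r / (k * ν)) + C * (μ * r / (k * ν))) :=
          mul_le_mul_of_nonneg_left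
            (add_le_add_left (mul_le_mul_of_nonneg_left hmono hC0) _) hR.le
      _ = C * ((R + 1) * (2 * (μ * r / (k * ν)))) := by ring
      _ < ν * (k / (2 * μ * r * (R + 1))) * ((R + 1) * (2 * (μ * r / (k * ν)))) :=
          mul_lt_mul_of_pos_right hC (by positivity)
      _ = 1 := by field_simp
  calc _ ≤ (R + 1) * (C * (μ * r / (t * ν)) * tensorSq (hankel k (X - M)) +
        C * (μ * r / (k * ν)) * tensorSq (hankel k (X - M))) := by gcongr
    _ = (R + 1) * (C * (μ * r / (t * ν)) + C * (μ * r / (k * ν))) *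
        tensorSq (hankel k (X - M)) := by ring
    _ < 1 * tensorSq (hankel k (X - M)) := mul_lt_mul_of_pos_right hsmall hpos
    _ = _ := one_mul _

end Hankel

end TIDT

end

theorem theorem4p1 {p : ℕ} (n : Fin p → ℕ) [∀ j, NeZero (n j)] (t k : ℕ)
    (hk : 1 ≤ k) (hkt : k ≤ t) (M : TIDT.Series n t) (μ : ℝ) (hμ : 0 < μ) (r : ℕ)
    (hM : TIDT.HankelIncoherent k μ r M)
    (Ω : Finset (Fin t × TIDT.Idx n))
    (hΩ : r ≠ 0 →
      TIDT.samplingRate Ω >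
        1 - (k : ℝ) / (2 * μ * r * ((TIDT.multiRankSum (TIDT.hankel k M) : ℝ) + 1) * t)) :
    TIDT.IsSolution k Ω M M ∧ ∀ X : TIDT.Series n t, TIDT.IsSolution k Ω M X → X = M := by
  refine ⟨⟨rfl, fun Y hY => ?_⟩, fun X hX => ?_⟩
  · by_cases hYM : Y = M
    · rw [hYM]
    · exact (TIDT.tensorNuclearNorm_hankel_lt hk hkt hμ hM hΩ hY hYM).le
  · by_contra hXM
    exact absurd (TIDT.tensorNuclearNorm_hankel_lt hk hkt hμ hM hΩ hX.1 hXM)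
      (not_lt.2 (hX.2 M rfl))
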